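/- **Theorem 2.1.** Let $X$ be a separable real Banach space, let $Z$ be a separable real normed space with dual $Z^*$, and let $f : X \to Z^*$ be a Lipschitz map (with respect to the dual norm). A Borel set $A \subseteq X$ is called a *zero set* if there is a Borel probability measure $\mu$ on $X$ such that $\int \chi_A(x-y)\,d\mu(y) = 0$ for every $x \in X$. A property holds *for almost all* $x_0 \in X$ if the set of points $x_0$ at which it fails is a zero set. The map $f$ is *$w^*$-differentiable* at $x_0 \in X$ if there is a linear map $(D^*f)_{x_0} : X \to Z^*$ such that for every $x \in X$ $$(D^*f)_{x_0}(x) = w^*\text{-}\lim_{t \to 0} \frac{f(x_0 + t x) - f(x_0)}{t};$$ this (unique) map is called the $w^*$-derivative of $f$ at $x_0$. Then $f$ is $w^*$-differentiable at almost all $x_0 \in X$. If moreover $f$ is a Lipschitz embedding, i.e. there is also a constant $c > 0$ with $\|f(x) - f(y)\| \ge c\|x - y\|$ for all $x, y \in X$, then for almost all $x_0 \in X$ the $w^*$-derivative $(D^*f)_{x_0}$ exists and is a linear isomorphism of $X$ onto its range $(D^*f)_{x_0}(X) \subseteq Z^*$, that is, a linear homeomorphism for the norm topologies. -/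

import Mathlib

open Filter Topology MeasureTheory

/-- A Borel subset `A` of `X` is a zero set (in the sense of Christensen) if it has a test measure:
a Borel probability measure `μ` on `X` such that the convolution `χ_A * μ` vanishes identically,
i.e. `∫ χ_A (x - y) dμ(y) = 0` for all `x`. -/
def IsZeroSet {X : Type*} [AddGroup X] [MeasurableSpace X] (A : Set X) : Prop :=
  MeasurableSet A ∧ ∃ μ : Measure X, IsProbabilityMeasure μ ∧
    ∀ x : X, ∫⁻ y, A.indicator 1 (x - y) ∂μ = 0

/-- A property holds almost everywhere on `X` if it holds outside a zero set: the set of points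
where it fails is (Borel and) a zero set. -/
def HoldsAlmostEverywhere {X : Type*} [AddGroup X] [MeasurableSpace X] (P : X → Prop) : Prop :=
  IsZeroSet {x | ¬ P x}

/-- The linear map `T : X → Z*` is the weak-star derivative of `f : X → Z*` at `x₀`: for every
`x`, the difference quotients `(f (x₀ + t x) - f x₀) / t` converge to `T x` in the weak-star
topology of `Z*` as `t → 0`, `t ≠ 0`. -/
def HasWeakStarDerivAt {X Z : Type*} [NormedAddCommGroup X] [NormedSpace ℝ X]
    [NormedAddCommGroup Z] [NormedSpace ℝ Z]
    (f : X → StrongDual ℝ Z) (T : X →ₗ[ℝ] StrongDual ℝ Z) (x₀ : X) : Prop :=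
  ∀ x : X, Tendsto (fun t : ℝ => StrongDual.toWeakDual (t⁻¹ • (f (x₀ + t • x) - f x₀)))
    (𝓝[≠] 0) (𝓝 (StrongDual.toWeakDual (T x)))

/-- `f` is weak-star differentiable at `x₀`. -/
def WeakStarDifferentiableAt {X Z : Type*} [NormedAddCommGroup X] [NormedSpace ℝ X]
    [NormedAddCommGroup Z] [NormedSpace ℝ Z] (f : X → StrongDual ℝ Z) (x₀ : X) : Prop :=
  ∃ T : X →ₗ[ℝ] StrongDual ℝ Z, HasWeakStarDerivAt f T x₀

/-- `f` is a Lipschitz embedding: Lipschitz, and bounded below by a multiple of the distance. -/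
def IsLipschitzEmbedding {X Y : Type*} [PseudoEMetricSpace X] [PseudoEMetricSpace Y]
    (f : X → Y) : Prop :=
  (∃ K, LipschitzWith K f) ∧ ∃ K, AntilipschitzWith K f

/-- The linear map `T` is an (into) isomorphism: a linear homeomorphism of `X` onto its range,
where the range carries the norm topology of `Y`. -/
def IsIntoIsomorphism {X Y : Type*} [NormedAddCommGroup X] [NormedSpace ℝ X]
    [NormedAddCommGroup Y] [NormedSpace ℝ Y] (T : X →ₗ[ℝ] Y) : Prop :=
  ∃ e : X ≃L[ℝ] LinearMap.range T, ∀ x : X, (e x : Y) = T x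

/-! Fix dense sequences `u` in `X` and `w` in `Z`. Since difference quotients are Lipschitz in the
direction, uniformly in `t`, weak-star differentiability at a point reduces to countably many scalar
conditions: each `f · (w j)` has a line derivative along `u m`, additive on `u m + u n`. This makes
the exceptional set Borel, and by Rademacher in `ℝ × ℝ` each condition holds almost everywhere on
every translate of the plane of `u m`, `u n`.

One test measure handles all planes: the law of a random series whose `(m, n)` term is uniform on a
small parallelogram in directions `u m`, `u n`. Resampling that term alone and applying Fubini kills
every Borel set that is null on all translates of the plane.

For an embedding, the norm is only weak-star lower semicontinuous, so the lower bound does not pass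
to the limit of quotients. It is recovered almost everywhere on each line by integrating derivatives
near a density point (`LipschitzWith.ae_exists_lt_abs_deriv_eval`). The same measure then applies.
-/

/-! ### Test measures from random series -/

/-- Resampling one coordinate of an infinite product of probability measures does not change
the law. -/
theorem measurePreserving_update_infinitePi {ι : Type*} [DecidableEq ι] {Q : Type*}
    [MeasurableSpace Q] (ν : Measure Q) [IsProbabilityMeasure ν] (k : ι) :
    MeasurePreserving (fun p : (ι → Q) × Q => Function.update p.1 k p.2)
      ((Measure.infinitePi fun _ => ν).prod ν) (Measure.infinitePi fun _ => ν) := by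
  have hm : Measurable (fun p : (ι → Q) × Q => Function.update p.1 k p.2) := by
    refine measurable_pi_lambda _ fun i => ?_
    by_cases h : i = k
    · subst h; simpa using measurable_snd
    · simpa [Function.update_of_ne h] using! (measurable_pi_apply i).comp measurable_fst
  refine ⟨hm, Measure.eq_infinitePi _ fun s t ht => ?_⟩
  rw [Measure.map_apply hm (MeasurableSet.pi s.countable_toSet fun i _ => ht i)]
  by_cases hk : k ∈ s
  · have : (fun p : (ι → Q) × Q => Function.update p.1 k p.2) ⁻¹' (Set.pi s t)
        = (Set.pi (s.erase k : Finset ι) t) ×ˢ t k := by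
      ext p
      simp only [Set.mem_preimage, Set.mem_pi, Set.mem_prod, Finset.mem_coe, Finset.mem_erase]
      constructor
      · intro h
        refine ⟨fun i hi => ?_, by simpa using h k hk⟩
        simpa [Function.update_of_ne hi.1] using h i hi.2
      · rintro ⟨h1, h2⟩ i hi
        by_cases hik : i = k
        · subst hik; simpa using h2
        · simpa [Function.update_of_ne hik] using h1 i ⟨hik, hi⟩
    rw [this, Measure.prod_prod, Measure.infinitePi_pi _ fun i _ => ht i,
      Finset.prod_erase_mul s (fun i => ν (t i)) hk]
  · have : (fun p : (ι → Q) × Q => Function.update p.1 k p.2) ⁻¹' (Set.pi s t)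
        = (Set.pi s t) ×ˢ Set.univ := by
      ext p
      simp only [Set.mem_preimage, Set.mem_pi, Set.mem_prod, Finset.mem_coe, Set.mem_univ, and_true]
      refine forall₂_congr fun i hi => ?_
      rw [Function.update_of_ne (by rintro rfl; exact hk hi)]
    rw [this, Measure.prod_prod, Measure.infinitePi_pi _ fun i _ => ht i, measure_univ, mul_one]

/-- A summable family of bounded continuous random vectors has a common law `μ` such that every
measurable set that is null for all translates of the law of one of the vectors is null for all
translates of (the reflection of) `μ`. -/
theorem exists_measure_forall_translate_null {X : Type*} [NormedAddCommGroup X] [CompleteSpace X]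
    [MeasurableSpace X] [BorelSpace X] [SecondCountableTopology X]
    {ι : Type*} [Countable ι] {Q : Type*} [TopologicalSpace Q] [SecondCountableTopology Q]
    [MeasurableSpace Q] [BorelSpace Q] (ν : Measure Q) [IsProbabilityMeasure ν]
    (φ : ι → Q → X) (hφ : ∀ k, Continuous (φ k)) {b : ι → ℝ} (hb : Summable b)
    (hφb : ∀ k q, ‖φ k q‖ ≤ b k) :
    ∃ μ : Measure X, IsProbabilityMeasure μ ∧ ∀ k, ∀ A : Set X, MeasurableSet A →
      (∀ x, ∀ᵐ q ∂ν, x - φ k q ∉ A) → ∀ x, μ {y | x - y ∈ A} = 0 := by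
  classical
  let S : (ι → Q) → X := fun ω => ∑' k, φ k (ω k)
  have hS : Measurable S :=
    (continuous_tsum (fun k => (hφ k).comp (continuous_apply k)) hb
      fun k ω => hφb k (ω k)).measurable
  refine ⟨(Measure.infinitePi fun _ => ν).map S, Measure.isProbabilityMeasure_map hS.aemeasurable,
    fun k A hA h x => ?_⟩
  have hAx : MeasurableSet {y | x - y ∈ A} := (measurable_const.sub measurable_id) hA
  have hu := measurePreserving_update_infinitePi (ι := ι) ν k
  -- Fubini for the resampled law: with `ω` frozen, only the `k`-th term of the series varies, so
  -- the hypothesis at a shifted base point applies.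
  rw [Measure.map_apply hS hAx, ← hu.measure_preimage (hS hAx).nullMeasurableSet,
    Measure.measure_prod_null (hu.measurable (hS hAx))]
  refine Eventually.of_forall fun ω => ?_
  have hsum : ∀ ω : ι → Q, Summable fun k => φ k (ω k) := fun ω =>
    Summable.of_norm_bounded hb fun k => hφb k (ω k)
  have key : ∀ q, S (Function.update ω k q) = S ω - φ k (ω k) + φ k q := fun q => by
    have h1 : HasSum (fun i => φ i (Function.update ω k q i) - φ i (ω i))
        (S (Function.update ω k q) - S ω) := (hsum _).hasSum.sub (hsum _).hasSum
    have h2 := hasSum_single (f := fun i => φ i (Function.update ω k q i) - φ i (ω i)) k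
      fun i hi => by simp [Function.update_of_ne hi]
    have h3 := h1.unique h2
    simp only [Function.update_self] at h3
    rw [sub_eq_iff_eq_add] at h3
    rw [h3]; abel
  have := h (x - (S ω - φ k (ω k)))
  rw [ae_iff] at this
  simp only [not_not] at this
  refine measure_mono_null ?_ this
  intro q hq
  simp only [Set.mem_preimage, Set.mem_ofPred_eq, key] at hq ⊢
  rwa [← sub_sub] at hq

/-- The measure does not depend on `A`, so countably many exceptional sets share it. -/
theorem exists_measure_null_of_null_on_planes {X : Type*} [NormedAddCommGroup X] [NormedSpace ℝ X]
    [CompleteSpace X] [MeasurableSpace X] [BorelSpace X] [SecondCountableTopology X] (u : ℕ → X) :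
    ∃ μ : Measure X, IsProbabilityMeasure μ ∧ ∀ m n, ∀ A : Set X, MeasurableSet A →
      (∀ x, ∀ᵐ q : ℝ × ℝ, x + (q.1 • u m + q.2 • u n) ∉ A) → ∀ x, μ {y | x - y ∈ A} = 0 := by
  obtain ⟨b, hb0, s, hs, -⟩ := posSumOfEncodable (zero_lt_one' ℝ) (ℕ × ℕ)
  -- The scale makes the `k`-th term at most `b k` in norm; the minus sign below turns `x - φ k q`
  -- into `x + ...`.
  let c : ℕ × ℕ → ℝ := fun k => b k / (1 + ‖u k.1‖ + ‖u k.2‖)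
  have hc : ∀ k, 0 < c k := fun k => div_pos (hb0 k) (by positivity)
  obtain ⟨μ, hμ, h⟩ := exists_measure_forall_translate_null (X := X)
    (volume : Measure (unitInterval × unitInterval))
    (fun (k : ℕ × ℕ) q => (-c k) • ((q.1 : ℝ) • u k.1 + (q.2 : ℝ) • u k.2))
    (fun k => by fun_prop) hs.summable fun k q => by
      have h1 : ‖(q.1 : ℝ) • u k.1 + (q.2 : ℝ) • u k.2‖ ≤ 1 + ‖u k.1‖ + ‖u k.2‖ := by
        refine (norm_add_le _ _).trans ?_
        rw [norm_smul, norm_smul, Real.norm_of_nonneg q.1.2.1, Real.norm_of_nonneg q.2.2.1]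
        have := mul_le_mul_of_nonneg_right q.1.2.2 (norm_nonneg (u k.1))
        have := mul_le_mul_of_nonneg_right q.2.2.2 (norm_nonneg (u k.2))
        linarith
      rw [norm_smul, norm_neg, Real.norm_of_nonneg (hc k).le]
      calc _ ≤ c k * (1 + ‖u k.1‖ + ‖u k.2‖) := by gcongr; exact (hc k).le
        _ = b k := div_mul_cancel₀ _ (by positivity)
  refine ⟨μ, hμ, fun m n A hA hn => h (m, n) A hA fun x => ?_⟩
  have hmp := unitInterval.measurePreserving_coe.prod unitInterval.measurePreserving_coe
  have h1 : ∀ᵐ q : ℝ × ℝ, x + ((c (m, n) • q).1 • u m + (c (m, n) • q).2 • u n) ∉ A := by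
    have := hn x
    rw [ae_iff] at this ⊢
    have h2 := Measure.addHaar_preimage_smul (volume : Measure (ℝ × ℝ)) (hc (m, n)).ne'
      {q : ℝ × ℝ | ¬ x + (q.1 • u m + q.2 • u n) ∉ A}
    rw [this, mul_zero] at h2
    exact h2
  have h2 : ∀ᵐ q ∂((volume : Measure ℝ).restrict unitInterval).prod
      ((volume : Measure ℝ).restrict unitInterval),
      x + ((c (m, n) • q).1 • u m + (c (m, n) • q).2 • u n) ∉ A := by
    rw [Measure.prod_restrict]
    exact ae_restrict_of_ae h1
  filter_upwards [hmp.quasiMeasurePreserving.ae h2] with q hq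
  rw [neg_smul, sub_neg_eq_add, smul_add, smul_smul, smul_smul]
  exact hq

/-! ### Weak-star derivatives through countably many conditions -/

theorem exists_tendsto_of_forall_approx {α : Type*} {F : Filter α} [NeBot F] {h : α → ℝ}
    (H : ∀ ε > 0, ∃ (g : α → ℝ) (l : ℝ), Tendsto g F (𝓝 l) ∧ ∀ t, |h t - g t| ≤ ε) :
    ∃ l, Tendsto h F (𝓝 l) := by
  refine cauchy_map_iff_exists_tendsto.mp (Metric.cauchy_iff.2 ⟨inferInstance, fun ε hε => ?_⟩)
  obtain ⟨g, l, hg, hh⟩ := H (ε / 5) (by positivity)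
  refine ⟨_, image_mem_map (Metric.tendsto_nhds.1 hg (ε / 5) (by positivity)), ?_⟩
  rintro _ ⟨a, ha, rfl⟩ _ ⟨b, hb, rfl⟩
  have h1 := hh a
  have h2 := hh b
  simp only [Real.dist_eq, Set.mem_ofPred_eq, abs_lt, abs_le] at *
  constructor <;> linarith

theorem LipschitzWith.eval_strongDual {X Z : Type*} [SeminormedAddCommGroup X]
    [NormedAddCommGroup Z] [NormedSpace ℝ Z] {f : X → StrongDual ℝ Z} {K : NNReal}
    (hf : LipschitzWith K f) (z : Z) :
    LipschitzWith (K * ‖z‖₊) (fun y => f y z) := by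
  refine LipschitzWith.of_dist_le_mul fun x y => ?_
  rw [dist_eq_norm, ← sub_apply]
  refine (ContinuousLinearMap.le_opNorm _ _).trans ?_
  have := hf.dist_le_mul x y
  rw [dist_eq_norm] at this
  calc _ ≤ K * dist x y * ‖z‖ := by gcongr
    _ = _ := by push_cast; ring

section WeakStar

variable {X Z : Type*} [NormedAddCommGroup X] [NormedSpace ℝ X]
  [NormedAddCommGroup Z] [NormedSpace ℝ Z] {f : X → StrongDual ℝ Z} {K : NNReal} {x₀ : X}

theorem hasLineDerivAt_eval_iff {v : X} {z : Z} {l : ℝ} :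
    HasLineDerivAt ℝ (fun y => f y z) l x₀ v ↔
      Tendsto (fun t : ℝ => (t⁻¹ • (f (x₀ + t • v) - f x₀)) z) (𝓝[≠] 0) (𝓝 l) :=
  hasLineDerivAt_iff_tendsto_slope_zero

theorem hasWeakStarDerivAt_iff {T : X →ₗ[ℝ] StrongDual ℝ Z} :
    HasWeakStarDerivAt f T x₀ ↔ ∀ v z, HasLineDerivAt ℝ (fun y => f y z) (T v z) x₀ v := by
  simp only [hasLineDerivAt_eval_iff]
  exact forall_congr' fun v => tendsto_iff_forall_eval_tendsto_topDualPairing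

theorem LipschitzWith.norm_slope_sub_slope_le (hf : LipschitzWith K f) (t : ℝ) (v w : X) :
    ‖t⁻¹ • (f (x₀ + t • v) - f x₀) - t⁻¹ • (f (x₀ + t • w) - f x₀)‖ ≤ K * ‖v - w‖ := by
  have heq : t⁻¹ • (f (x₀ + t • v) - f x₀) - t⁻¹ • (f (x₀ + t • w) - f x₀) =
      t⁻¹ • (f (x₀ + t • v) - f (x₀ + t • w)) := by module
  rw [heq, norm_smul]
  rcases eq_or_ne t 0 with rfl | ht
  · simp; positivity
  have := hf.dist_le_mul (x₀ + t • v) (x₀ + t • w)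
  rw [dist_eq_norm, dist_eq_norm, add_sub_add_left_eq_sub, ← smul_sub, norm_smul] at this
  calc _ ≤ ‖t⁻¹‖ * (K * (‖t‖ * ‖v - w‖)) := by gcongr
    _ = (‖t⁻¹‖ * ‖t‖) * (K * ‖v - w‖) := by ring
    _ = _ := by rw [← norm_mul, inv_mul_cancel₀ ht]; simp

theorem LipschitzWith.norm_slope_le (hf : LipschitzWith K f) (t : ℝ) (v : X) :
    ‖t⁻¹ • (f (x₀ + t • v) - f x₀)‖ ≤ K * ‖v‖ := by
  simpa using hf.norm_slope_sub_slope_le (x₀ := x₀) t v 0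

/-- Line differentiability of all coordinates in all directions follows from a dense set of
coordinates and directions. -/
theorem LipschitzWith.lineDifferentiableAt_eval_of_dense (hf : LipschitzWith K f)
    {ι κ : Type*} {u : ι → X} (hu : DenseRange u) {w : κ → Z} (hw : DenseRange w)
    (h : ∀ m j, LineDifferentiableAt ℝ (fun y => f y (w j)) x₀ (u m)) (v : X) (z : Z) :
    LineDifferentiableAt ℝ (fun y => f y z) x₀ v := by
  suffices H : ∃ l, Tendsto (fun t : ℝ => (t⁻¹ • (f (x₀ + t • v) - f x₀)) z) (𝓝[≠] 0) (𝓝 l) by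
    obtain ⟨l, hl⟩ := H
    exact (hasLineDerivAt_eval_iff.2 hl).lineDifferentiableAt
  have step1 : ∀ m z, ∃ l,
      Tendsto (fun t : ℝ => (t⁻¹ • (f (x₀ + t • u m) - f x₀)) z) (𝓝[≠] 0) (𝓝 l) := fun m z => by
    refine exists_tendsto_of_forall_approx fun ε hε => ?_
    obtain ⟨j, hj⟩ := hw.exists_dist_lt z (ε := ε / (K * ‖u m‖ + 1)) (by positivity)
    refine ⟨_, _, hasLineDerivAt_eval_iff.1 (h m j).hasLineDerivAt, fun t => ?_⟩
    rw [← map_sub, ← Real.norm_eq_abs]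
    refine (ContinuousLinearMap.le_opNorm _ _).trans ?_
    rw [dist_eq_norm] at hj
    calc _ ≤ (K * ‖u m‖) * (ε / (K * ‖u m‖ + 1)) := by
          gcongr
          exact hf.norm_slope_le t _
      _ = ε * ((K * ‖u m‖) / (K * ‖u m‖ + 1)) := by ring
      _ ≤ ε * 1 := by
          gcongr
          rw [div_le_one (by positivity)]; linarith
      _ = ε := mul_one _
  refine exists_tendsto_of_forall_approx fun ε hε => ?_
  obtain ⟨m, hm⟩ := hu.exists_dist_lt v (ε := ε / (K * ‖z‖ + 1)) (by positivity)
  obtain ⟨l, hl⟩ := step1 m z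
  refine ⟨_, l, hl, fun t => ?_⟩
  rw [← sub_apply, ← Real.norm_eq_abs]
  refine (ContinuousLinearMap.le_opNorm _ _).trans ?_
  rw [dist_eq_norm] at hm
  calc _ ≤ (K * (ε / (K * ‖z‖ + 1))) * ‖z‖ := by
        gcongr
        exact (hf.norm_slope_sub_slope_le t _ _).trans (by gcongr)
    _ = ε * ((K * ‖z‖) / (K * ‖z‖ + 1)) := by ring
    _ ≤ ε * 1 := by
        gcongr
        rw [div_le_one (by positivity)]; linarith
    _ = ε := mul_one _

theorem LipschitzWith.abs_lineDeriv_eval_le (hf : LipschitzWith K f) (v : X) (z : Z) :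
    |lineDeriv ℝ (fun y => f y z) x₀ v| ≤ K * ‖v‖ * ‖z‖ := by
  have := norm_lineDeriv_le_of_lipschitz ℝ (x₀ := x₀) (v := v) (hf.eval_strongDual z)
  rw [Real.norm_eq_abs] at this
  refine this.trans (le_of_eq ?_)
  push_cast; ring

/-- A weak-star derivative of a Lipschitz map exists as soon as there are directional derivatives
for a dense set of coordinates and directions, and they are additive. -/
theorem LipschitzWith.weakStarDifferentiableAt_iff (hf : LipschitzWith K f)
    {ι κ : Type*} {u : ι → X} (hu : DenseRange u) {w : κ → Z} (hw : DenseRange w) :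
    WeakStarDifferentiableAt f x₀ ↔ ∀ m n j,
      LineDifferentiableAt ℝ (fun y => f y (w j)) x₀ (u m) ∧
      lineDeriv ℝ (fun y => f y (w j)) x₀ (u m + u n) =
        lineDeriv ℝ (fun y => f y (w j)) x₀ (u m) + lineDeriv ℝ (fun y => f y (w j)) x₀ (u n) := by
  constructor
  · rintro ⟨T, hT⟩ m n j
    rw [hasWeakStarDerivAt_iff] at hT
    refine ⟨(hT _ _).lineDifferentiableAt, ?_⟩
    simp [(hT _ _).lineDeriv]
  intro h
  set D : X → Z → ℝ := fun v z => lineDeriv ℝ (fun y => f y z) x₀ v with hD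
  have hDl : ∀ v z, HasLineDerivAt ℝ (fun y => f y z) (D v z) x₀ v := fun v z => by
    rcases isEmpty_or_nonempty ι with hι | ⟨⟨i⟩⟩
    · exact (hu.nonempty_iff.2 ⟨v⟩).elim fun i => hι.elim i
    exact (hf.lineDifferentiableAt_eval_of_dense hu hw (fun m j => (h m i j).1) v z).hasLineDerivAt
  have hDt := fun v z => hasLineDerivAt_eval_iff.1 (hDl v z)
  have hadd : ∀ v z z', D v (z + z') = D v z + D v z' := fun v z z' =>
    tendsto_nhds_unique (hDt v (z + z')) (by
      refine ((hDt v z).add (hDt v z')).congr fun t => (map_add _ z z').symm)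
  have hsmul : ∀ v (c : ℝ) z, D v (c • z) = c * D v z := fun v c z =>
    tendsto_nhds_unique (hDt v (c • z)) (by simpa [mul_left_comm] using ((hDt v z).const_mul c))
  have hb : ∀ v z, ‖D v z‖ ≤ K * ‖v‖ * ‖z‖ := fun v z => hf.abs_lineDeriv_eval_le v z
  let T₀ : X → StrongDual ℝ Z := fun v =>
    LinearMap.mkContinuous { toFun := D v, map_add' := hadd v, map_smul' := hsmul v }
      (K * ‖v‖) (hb v)
  have hT₀ : ∀ v z, T₀ v z = D v z := fun _ _ => rfl
  have hlip : LipschitzWith K T₀ := by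
    refine LipschitzWith.of_dist_le_mul fun v v' => ?_
    rw [dist_eq_norm, dist_eq_norm]
    refine ContinuousLinearMap.opNorm_le_bound _ (by positivity) fun z => ?_
    rw [sub_apply, hT₀, hT₀]
    refine le_of_tendsto ((hDt v z).sub (hDt v' z)).norm (Eventually.of_forall fun t => ?_)
    rw [← sub_apply]
    exact ContinuousLinearMap.le_of_opNorm_le _ (hf.norm_slope_sub_slope_le t v v') z
  -- Additivity is known only on dense directions and coordinates; continuity of `T₀` and of each
  -- functional extends it.
  have hTadd : ∀ v v', T₀ (v + v') = T₀ v + T₀ v' := by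
    have hc := hlip.continuous
    refine hu.induction_on₂ (isClosed_eq (by fun_prop) (by fun_prop)) fun m n => ?_
    refine DFunLike.coe_injective (hw.equalizer (map_continuous _) (map_continuous _) ?_)
    funext j
    exact (h m n j).2
  refine ⟨{ toFun := T₀, map_add' := hTadd, map_smul' := fun c v => ?_ },
    hasWeakStarDerivAt_iff.2 hDl⟩
  ext z
  exact lineDeriv_smul (f := fun y => f y z)

theorem HasWeakStarDerivAt.norm_le {T : X →ₗ[ℝ] StrongDual ℝ Z} (hT : HasWeakStarDerivAt f T x₀)
    (hf : LipschitzWith K f) (v : X) : ‖T v‖ ≤ K * ‖v‖ := by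
  refine ContinuousLinearMap.opNorm_le_bound _ (by positivity) fun z => ?_
  rw [← (hasWeakStarDerivAt_iff.1 hT v z).lineDeriv]
  exact hf.abs_lineDeriv_eval_le v z

theorem isIntoIsomorphism_iff {Y : Type*} [NormedAddCommGroup Y] [NormedSpace ℝ Y]
    {T : X →ₗ[ℝ] Y} (hT : Continuous T) :
    IsIntoIsomorphism T ↔ ∃ C : ℝ, ∀ v, ‖v‖ ≤ C * ‖T v‖ := by
  constructor
  · rintro ⟨e, he⟩
    refine ⟨‖(e.symm : LinearMap.range T →L[ℝ] X)‖, fun v => ?_⟩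
    have := (e.symm : LinearMap.range T →L[ℝ] X).le_opNorm (e v)
    simpa [← he] using this
  · rintro ⟨C, hC⟩
    have hinj : Function.Injective T := by
      refine (injective_iff_map_eq_zero T).2 fun v hv => norm_le_zero_iff.1 ?_
      simpa [hv] using hC v
    let T' : X →L[ℝ] Y := ⟨T, hT⟩
    refine ⟨(LinearEquiv.ofInjective T hinj).toContinuousLinearEquivOfBounds ‖T'‖ C
      (fun v => T'.le_opNorm v) fun y => ?_, fun v => rfl⟩
    obtain ⟨v, rfl⟩ := (LinearEquiv.ofInjective T hinj).surjective y
    simpa using hC v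

/-- The lower bound `‖v‖ ≤ i * ‖T v‖` is tested on `u`, and the dual norm on `w`. A natural constant
`i` keeps the condition countable, hence Borel. -/
theorem LipschitzWith.exists_hasWeakStarDerivAt_isIntoIsomorphism_iff (hf : LipschitzWith K f)
    {ι κ : Type*} {u : ι → X} (hu : DenseRange u) {w : κ → Z} (hw : DenseRange w) :
    (∃ T : X →ₗ[ℝ] StrongDual ℝ Z, HasWeakStarDerivAt f T x₀ ∧ IsIntoIsomorphism T) ↔
      WeakStarDifferentiableAt f x₀ ∧ ∃ i : ℕ, ∀ m, u m ≠ 0 → ∃ j,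
        ‖u m‖ * ‖w j‖ < i * |lineDeriv ℝ (fun y => f y (w j)) x₀ (u m)| := by
  have hcont : ∀ T : X →ₗ[ℝ] StrongDual ℝ Z, HasWeakStarDerivAt f T x₀ → Continuous T :=
    fun T hT => AddMonoidHomClass.continuous_of_bound T K (hT.norm_le hf)
  constructor
  · rintro ⟨T, hT, hi⟩
    refine ⟨⟨T, hT⟩, ?_⟩
    obtain ⟨C, hC⟩ := (isIntoIsomorphism_iff (hcont T hT)).1 hi
    obtain ⟨i, hi⟩ := exists_nat_gt (max C 0)
    have hiC : C < i := (le_max_left _ _).trans_lt hi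
    have hi0 : (0 : ℝ) < i := (le_max_right _ _).trans_lt hi
    refine ⟨i, fun m hm => ?_⟩
    by_contra! hcon
    have h1 : ∀ z, ‖T (u m) z‖ ≤ ‖u m‖ / i * ‖z‖ := by
      refine fun z => hw.induction_on (p := fun z => ‖T (u m) z‖ ≤ ‖u m‖ / i * ‖z‖) z
        (isClosed_le (by fun_prop) (by fun_prop)) fun j => ?_
      have := hcon j
      rw [(hasWeakStarDerivAt_iff.1 hT _ _).lineDeriv] at this
      rw [Real.norm_eq_abs, div_mul_eq_mul_div, le_div_iff₀' hi0]
      exact this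
    have h2 := ContinuousLinearMap.opNorm_le_bound _ (by positivity) h1
    rw [le_div_iff₀' hi0] at h2
    have h3 := hC (u m)
    have h4 : 0 < ‖u m‖ := norm_pos_iff.2 hm
    have h5 : 0 < ‖T (u m)‖ := by
      refine (norm_nonneg _).lt_of_ne fun h => ?_
      rw [← h] at h3; linarith
    nlinarith
  · rintro ⟨⟨T, hT⟩, i, hi⟩
    refine ⟨T, hT, (isIntoIsomorphism_iff (hcont T hT)).2 ⟨i, ?_⟩⟩
    have hc := hcont T hT
    refine fun v => hu.induction_on (p := fun v => ‖v‖ ≤ i * ‖T v‖) v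
      (isClosed_le (by fun_prop) (by fun_prop)) fun m => ?_
    rcases eq_or_ne (u m) 0 with hm | hm
    · simp [hm]
    obtain ⟨j, hj⟩ := hi m hm
    rw [(hasWeakStarDerivAt_iff.1 hT _ _).lineDeriv] at hj
    have h1 : ‖u m‖ * ‖w j‖ < i * ‖T (u m)‖ * ‖w j‖ := by
      refine hj.trans_le ?_
      rw [mul_assoc]
      gcongr
      exact (T (u m)).le_opNorm _
    exact (lt_of_mul_lt_mul_right h1 (norm_nonneg _)).le

end WeakStar

/-! ### Almost everywhere statements on lines and planes -/

/-- If a Lipschitz curve `g` in a dual space satisfies `|s - t| ≤ C ‖g s - g t‖`, then almost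
everywhere its weak-star derivative has norm at least `1 / C'`, for every `C' > C`. -/
theorem LipschitzWith.ae_exists_lt_abs_deriv_eval {Z : Type*} [NormedAddCommGroup Z]
    [NormedSpace ℝ Z] {g : ℝ → StrongDual ℝ Z} {K : NNReal} (hg : LipschitzWith K g)
    {κ : Type*} [Countable κ] {w : κ → Z} (hw : DenseRange w) {C C' : ℝ} (hC : 0 < C) (hCC' : C < C')
    (hlow : ∀ s t, |s - t| ≤ C * ‖g s - g t‖) :
    ∀ᵐ s, ∃ j, ‖w j‖ < C' * |deriv (fun t => g t (w j)) s| := by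
  have hC' : 0 < C' := hC.trans hCC'
  let G : Set ℝ := {s | ∃ j, ‖w j‖ < C' * |deriv (fun t => g t (w j)) s|}
  have hG : MeasurableSet G := by
    simp only [G, Set.ofPred_exists]
    exact MeasurableSet.iUnion fun j =>
      measurableSet_lt measurable_const ((measurable_deriv _).abs.const_mul _)
  filter_upwards [Besicovitch.ae_tendsto_measure_inter_div_of_measurableSet volume hG] with s hs
  by_contra hsG
  replace hsG : s ∉ G := hsG
  rw [Set.indicator_of_notMem hsG] at hs
  -- Chosen so that `K * ε < 1 / C - 1 / C'`; the `+ 1` covers `K = 0`.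
  let ε : ℝ := (1 / C - 1 / C') / (K + 1)
  have hε0 : 0 < 1 / C - 1 / C' := sub_pos.2 (one_div_lt_one_div_of_lt hC hCC')
  have hε : 0 < ε := by positivity
  obtain ⟨r, hr, hr0⟩ := ((hs.eventually_lt_const (u := ENNReal.ofReal ε) (by simpa using hε)).and
    self_mem_nhdsWithin).exists
  have hr0 : 0 < r := hr0
  have hab : s - r ≤ s + r := by linarith
  rw [Real.closedBall_eq_Icc, Real.volume_Icc, show s + r - (s - r) = 2 * r by ring,
    ENNReal.div_lt_iff (.inl (by simp [hr0])) (.inl ENNReal.ofReal_ne_top), ← ENNReal.ofReal_mul hε.le] at hr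
  have hGr : (volume.restrict (Set.Icc (s - r) (s + r))).real G ≤ ε * (2 * r) := by
    rw [measureReal_restrict_apply hG]
    exact ENNReal.toReal_le_of_le_ofReal (by positivity) hr.le
  have key : ∀ j, ‖(g (s + r) - g (s - r)) (w j)‖ ≤
      (2 * r / C' + K * (ε * (2 * r))) * ‖w j‖ := fun j => by
    have hl := hg.eval_strongDual (w j)
    rw [sub_apply, ← (hl.lipschitzOnWith (s := Set.uIcc (s - r)
      (s + r))).absolutelyContinuousOnInterval.integral_deriv_eq_sub,
      intervalIntegral.integral_of_le hab, ← integral_Icc_eq_integral_Ioc]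
    -- Off `G` the derivative is small by definition of `G`; on `G`, which has density zero at `s`,
    -- the Lipschitz bound suffices.
    have hbd : ∀ t, ‖deriv (fun t => g t (w j)) t‖ ≤
        ‖w j‖ / C' + G.indicator (fun _ => K * ‖w j‖) t := fun t => by
      by_cases ht : t ∈ G
      · rw [Set.indicator_of_mem ht]
        have := norm_deriv_le_of_lipschitz (x₀ := t) hl
        push_cast at this
        have : 0 ≤ ‖w j‖ / C' := by positivity
        linarith
      · rw [Set.indicator_of_notMem ht, add_zero, le_div_iff₀' hC']
        exact not_lt.1 fun h => ht ⟨j, h⟩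
    refine (norm_integral_le_of_norm_le (((integrable_const _).add
      ((integrable_const _).indicator hG))) (Eventually.of_forall hbd)).trans ?_
    rw [integral_add' (integrable_const _) ((integrable_const _).indicator hG),
      integral_indicator_const _ hG, integral_const, measureReal_restrict_apply_univ,
      Real.volume_real_Icc_of_le hab, smul_eq_mul, smul_eq_mul]
    calc _ ≤ (s + r - (s - r)) * (‖w j‖ / C') + (ε * (2 * r)) * (K * ‖w j‖) := by gcongr
      _ = _ := by ring
  have hnorm : ‖g (s + r) - g (s - r)‖ ≤ 2 * r / C' + K * (ε * (2 * r)) :=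
    ContinuousLinearMap.opNorm_le_bound _ (by positivity) fun z =>
      hw.induction_on (p := fun z => ‖(g (s + r) - g (s - r)) z‖ ≤ _ * ‖z‖) z
        (isClosed_le (by fun_prop) (by fun_prop)) key
  have h1 := hlow (s + r) (s - r)
  rw [show s + r - (s - r) = 2 * r by ring, abs_of_pos (by positivity)] at h1
  have h2 : 2 * r / C ≤ 2 * r / C' + K * (ε * (2 * r)) := by
    refine le_trans ?_ hnorm
    rwa [div_le_iff₀' hC]
  have h3 : (K + 1) * ε = 1 / C - 1 / C' := mul_div_cancel₀ _ (by positivity)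
  have h4 : 2 * r * (1 / C - 1 / C') ≤ 2 * r * (K * ε) := by
    have : 2 * r * (1 / C - 1 / C') = 2 * r / C - 2 * r / C' := by ring
    nlinarith
  have h5 := le_of_mul_le_mul_left h4 (by positivity)
  linarith

/-- Rademacher on `ℝ × ℝ`: where the restriction is differentiable, its line derivatives come from
one linear map. -/
theorem LipschitzWith.ae_lineDeriv_add_on_plane {X : Type*} [NormedAddCommGroup X]
    [NormedSpace ℝ X] {φ : X → ℝ} {K : NNReal} (hφ : LipschitzWith K φ) (x u v : X) :
    ∀ᵐ q : ℝ × ℝ, LineDifferentiableAt ℝ φ (x + (q.1 • u + q.2 • v)) u ∧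
      lineDeriv ℝ φ (x + (q.1 • u + q.2 • v)) (u + v) =
        lineDeriv ℝ φ (x + (q.1 • u + q.2 • v)) u + lineDeriv ℝ φ (x + (q.1 • u + q.2 • v)) v := by
  let L : ℝ × ℝ →L[ℝ] X := (ContinuousLinearMap.fst ℝ ℝ ℝ).smulRight u +
    (ContinuousLinearMap.snd ℝ ℝ ℝ).smulRight v
  have hL : ∀ q, L q = q.1 • u + q.2 • v := fun q => rfl
  have hg : LipschitzWith (K * (0 + ‖L‖₊)) (fun q => φ (x + L q)) :=
    hφ.comp ((LipschitzWith.const x).add L.lipschitz)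
  filter_upwards [hg.ae_differentiableAt (μ := volume)] with q hq
  have key : ∀ p, HasLineDerivAt ℝ φ (fderiv ℝ (fun q => φ (x + L q)) q p)
      (x + (q.1 • u + q.2 • v)) (L p) := fun p => by
    have := hq.hasFDerivAt.hasLineDerivAt p
    unfold HasLineDerivAt at this ⊢
    simpa only [map_add, map_smul, ← add_assoc, ← hL] using this
  have h1 := key (1, 0)
  have h2 := key (0, 1)
  have h3 := key ((1, 0) + (0, 1))
  rw [map_add L, map_add] at h3
  simp only [show L (1, 0) = u by simp [hL], show L (0, 1) = v by simp [hL]] at h1 h2 h3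
  exact ⟨h1.lineDifferentiableAt, by rw [h1.lineDeriv, h2.lineDeriv, h3.lineDeriv]⟩

theorem LipschitzWith.ae_exists_lt_abs_lineDeriv_eval {X Z : Type*} [NormedAddCommGroup X]
    [NormedSpace ℝ X] [NormedAddCommGroup Z] [NormedSpace ℝ Z] {f : X → StrongDual ℝ Z}
    {K : NNReal} (hf : LipschitzWith K f) {κ : Type*} [Countable κ] {w : κ → Z}
    (hw : DenseRange w) {C C' : ℝ} (hC : 0 < C) (hCC' : C < C')
    (hlow : ∀ x y, ‖x - y‖ ≤ C * ‖f x - f y‖) (p : X) {u : X} (hu : u ≠ 0) :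
    ∀ᵐ s : ℝ, ∃ j, ‖u‖ * ‖w j‖ < C' * |lineDeriv ℝ (fun y => f y (w j)) (p + s • u) u| := by
  have hu0 : 0 < ‖u‖ := norm_pos_iff.2 hu
  have hg : LipschitzWith (K * ‖u‖₊) (fun s : ℝ => f (p + s • u)) :=
    LipschitzWith.of_dist_le_mul fun s t => by
      refine (hf.dist_le_mul _ _).trans_eq ?_
      rw [dist_add_left, dist_eq_norm, ← sub_smul, norm_smul, dist_eq_norm]
      push_cast; ring
  have hlow' : ∀ s t : ℝ, |s - t| ≤ C / ‖u‖ * ‖f (p + s • u) - f (p + t • u)‖ := fun s t => by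
    have := hlow (p + s • u) (p + t • u)
    rw [add_sub_add_left_eq_sub, ← sub_smul, norm_smul, Real.norm_eq_abs] at this
    rwa [div_mul_eq_mul_div, le_div_iff₀ hu0]
  filter_upwards [hg.ae_exists_lt_abs_deriv_eval hw (div_pos hC hu0)
    (div_lt_div_of_pos_right hCC' hu0) hlow'] with s ⟨j, hj⟩
  refine ⟨j, ?_⟩
  have : lineDeriv ℝ (fun y => f y (w j)) (p + s • u) u =
      deriv (fun t : ℝ => f (p + t • u) (w j)) s := by
    have h := deriv_comp_const_add (fun t : ℝ => f (p + t • u) (w j)) s 0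
    rw [add_zero] at h
    rw [← h]
    simp only [lineDeriv, add_smul, add_assoc]
  rwa [this, ← lt_div_iff₀' hu0, ← div_mul_eq_mul_div]

/-! ### Assembling the theorem -/

theorem isZeroSet_iff {X : Type*} [AddGroup X] [MeasurableSpace X] [MeasurableSub X] {A : Set X}
    (hA : MeasurableSet A) : IsZeroSet A ↔ ∃ μ : Measure X, IsProbabilityMeasure μ ∧
      ∀ x, μ {y | x - y ∈ A} = 0 := by
  simp only [IsZeroSet, hA, true_and]
  refine exists_congr fun μ => and_congr_right fun _ => forall_congr' fun x => ?_
  have hAx : MeasurableSet {y | x - y ∈ A} := measurable_const_sub x hA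
  have : ∀ y, A.indicator (1 : X → ENNReal) (x - y) =
      {y | x - y ∈ A}.indicator (1 : X → ENNReal) y := fun y => rfl
  simp only [this]
  rw [lintegral_indicator_one hAx]

theorem theorem2p1 {X Z : Type*}
    [NormedAddCommGroup X] [NormedSpace ℝ X] [CompleteSpace X]
    [TopologicalSpace.SeparableSpace X] [MeasurableSpace X] [BorelSpace X]
    [NormedAddCommGroup Z] [NormedSpace ℝ Z] [TopologicalSpace.SeparableSpace Z]
    (f : X → StrongDual ℝ Z) (hf : ∃ K, LipschitzWith K f) :
    HoldsAlmostEverywhere (fun x₀ : X => WeakStarDifferentiableAt f x₀) ∧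
    (IsLipschitzEmbedding f →
      HoldsAlmostEverywhere (fun x₀ : X => ∃ T : X →ₗ[ℝ] StrongDual ℝ Z,
        HasWeakStarDerivAt f T x₀ ∧ IsIntoIsomorphism T)) := by
  obtain ⟨K, hf⟩ := hf
  have : SecondCountableTopology X := UniformSpace.secondCountable_of_separable X
  let u := TopologicalSpace.denseSeq X
  let w := TopologicalSpace.denseSeq Z
  have hu : DenseRange u := TopologicalSpace.denseRange_denseSeq X
  have hw : DenseRange w := TopologicalSpace.denseRange_denseSeq Z
  have hfw : ∀ j, LipschitzWith (K * ‖w j‖₊) (fun y => f y (w j)) :=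
    fun j => hf.eval_strongDual (w j)
  have hmeas : ∀ j v, Measurable fun x => lineDeriv ℝ (fun y => f y (w j)) x v :=
    fun j v => measurable_lineDeriv (hfw j).continuous
  let A : ℕ → ℕ → ℕ → Set X := fun m n j =>
    {x₀ | LineDifferentiableAt ℝ (fun y => f y (w j)) x₀ (u m) ∧
      lineDeriv ℝ (fun y => f y (w j)) x₀ (u m + u n) =
        lineDeriv ℝ (fun y => f y (w j)) x₀ (u m) + lineDeriv ℝ (fun y => f y (w j)) x₀ (u n)}
  have hA : ∀ m n j, MeasurableSet (A m n j) := fun m n j =>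
    (measurableSet_lineDifferentiableAt (hfw j).continuous).inter
      (measurableSet_eq_fun (hmeas _ _) ((hmeas _ _).add (hmeas _ _)))
  have hWS : {x₀ | WeakStarDifferentiableAt f x₀} = ⋂ m, ⋂ n, ⋂ j, A m n j := by
    ext x₀
    simp only [Set.mem_ofPred_eq, hf.weakStarDifferentiableAt_iff hu hw, Set.mem_iInter, A]
  have hWSm : MeasurableSet {x₀ | WeakStarDifferentiableAt f x₀} := by
    rw [hWS]
    exact .iInter fun m => .iInter fun n => .iInter fun j => hA m n j
  obtain ⟨μ, hμ, hnull⟩ := exists_measure_null_of_null_on_planes u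
  have hWS0 : ∀ x, μ {y | x - y ∈ {x₀ | ¬ WeakStarDifferentiableAt f x₀}} = 0 := fun x => by
    have : {y | x - y ∈ {x₀ | ¬ WeakStarDifferentiableAt f x₀}} =
        ⋃ m, ⋃ n, ⋃ j, {y | x - y ∈ (A m n j)ᶜ} := by
      ext y
      have := Set.ext_iff.1 hWS (x - y)
      simp only [Set.mem_ofPred_eq, Set.mem_iInter] at this
      simp [this]
    simp only [this, measure_iUnion_null_iff]
    exact fun m n j => hnull m n _ (hA m n j).compl (fun x => by
      filter_upwards [(hfw j).ae_lineDeriv_add_on_plane x (u m) (u n)] with q hq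
      exact fun h => h hq) x
  refine ⟨(isZeroSet_iff hWSm.compl).2 ⟨μ, hμ, hWS0⟩, fun ⟨_, C, hC⟩ => ?_⟩
  let B : ℕ → ℕ → Set X := fun i m => {x₀ | u m ≠ 0 → ∃ j,
    ‖u m‖ * ‖w j‖ < i * |lineDeriv ℝ (fun y => f y (w j)) x₀ (u m)|}
  have hB : ∀ i m, MeasurableSet (B i m) := fun i m => by
    by_cases hm : u m = 0
    · simp [B, hm]
    · simp only [B, ne_eq, hm, not_false_eq_true, forall_const, Set.ofPred_exists]
      exact .iUnion fun j => measurableSet_lt measurable_const ((hmeas _ _).abs.const_mul _)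
  have hiso : {x₀ | ∃ T : X →ₗ[ℝ] StrongDual ℝ Z, HasWeakStarDerivAt f T x₀ ∧ IsIntoIsomorphism T}
      = {x₀ | WeakStarDifferentiableAt f x₀} ∩ ⋃ i, ⋂ m, B i m := by
    ext x₀
    simp only [Set.mem_ofPred_eq, hf.exists_hasWeakStarDerivAt_isIntoIsomorphism_iff hu hw,
      Set.mem_inter_iff, Set.mem_iUnion, Set.mem_iInter, B]
  have hisom := hWSm.inter (.iUnion fun i => .iInter fun m => hB i m)
  rw [← hiso] at hisom
  refine (isZeroSet_iff hisom.compl).2 ⟨μ, hμ, fun x => ?_⟩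
  -- The `+ 1` keeps the constant positive when `C = 0`.
  obtain ⟨i, hi⟩ := exists_nat_gt ((C : ℝ) + 1)
  have hlow : ∀ x y, ‖x - y‖ ≤ ((C : ℝ) + 1) * ‖f x - f y‖ := fun x y => by
    have := hC.le_mul_dist x y
    rw [dist_eq_norm, dist_eq_norm] at this
    nlinarith [norm_nonneg (f x - f y)]
  have hBnull : ∀ m, μ {y | x - y ∈ (B i m)ᶜ} = 0 := fun m => by
    -- The degenerate plane with both directions `u m`: Fubini in `q` leaves a statement about
    -- lines.
    refine hnull m m _ (hB i m).compl (fun x => ?_) x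
    by_cases hm : u m = 0
    · simp [B, hm]
    have hcont : Continuous fun q : ℝ × ℝ => x + (q.1 • u m + q.2 • u m) := by fun_prop
    have hms : MeasurableSet {q : ℝ × ℝ | ¬ x + (q.1 • u m + q.2 • u m) ∉ (B i m)ᶜ} := by
      simp only [not_not]
      exact hcont.measurable (hB i m).compl
    rw [ae_iff, Measure.volume_eq_prod, Measure.measure_prod_null hms]
    refine Eventually.of_forall fun s => ?_
    have h := hf.ae_exists_lt_abs_lineDeriv_eval hw (by positivity) hi hlow (x + s • u m) hm
    refine measure_mono_null (fun t ht => ?_) (ae_iff.1 h)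
    simp only [not_not, Set.mem_preimage, Set.mem_ofPred_eq, Set.mem_compl_iff, B, ← add_assoc] at ht
    exact fun hj => ht fun _ => hj
  refine measure_mono_null (t := {y | x - y ∈ {x₀ | ¬ WeakStarDifferentiableAt f x₀}} ∪
    ⋃ m, {y | x - y ∈ (B i m)ᶜ}) (fun y hy => ?_)
    (measure_union_null (hWS0 x) (measure_iUnion_null hBnull))
  by_contra hcon
  simp only [Set.mem_union, Set.mem_iUnion, Set.mem_ofPred_eq, Set.mem_compl_iff, not_or, not_not,
    not_exists] at hcon
  refine hy ((Set.ext_iff.1 hiso (x - y)).2 ⟨hcon.1, ?_⟩)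
  exact Set.mem_iUnion.2 ⟨i, Set.mem_iInter.2 hcon.2⟩
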